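/- Let $h:\mathbb{R}\to[0,\infty)$ be measurable and $\psi:\mathbb{R}\to\mathbb{R}$ be such that, for every $x\in\mathbb{R}$, $f_{Y|X}(y|x)=h(y)\,e^{xy-\psi(x)}$ is a probability density in $y\in\mathbb{R}$ (a natural exponential family). Assume that $\{y: h(y)>0\}$ is dense in $\mathbb{R}$ (for instance, $h>0$ almost everywhere), and that $$\sup_{x\in\mathbb{R}}\Big(\frac{x^2}{2}-\psi(x)\Big)<\infty .$$ Let $a\in[0,1)$. For a probability measure $P$ on $\mathbb{R}$ (the prior, i.e. the law of $X$), put $f_Y(y)=\int f_{Y|X}(y|x)\,P(dx)$, and for $f_Y(y)\neq0$ let $P_{X|Y=y}(dx)=\frac{f_{Y|X}(y|x)}{f_Y(y)}\,P(dx)$ be the conditional law of $X$ given $Y=y$, with distribution function $F_{X|Y=y}$ and conditional median $\mathsf{m}(X|Y=y)=\inf\{x: F_{X|Y=y}(x)\ge \tfrac12\}$. Consider the conditions (i) $\mathsf{m}(X|Y=y)=ay$ for every $y$ with $f_Y(y)\neq0$; (ii) $\mathbb{E}\big[\operatorname{sign}(X-ay)\,h(y)\,e^{Xy-\psi(X)}\big]=0$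 for every $y\in\mathbb{R}$, the expectation being that of an integrable function and $\operatorname{sign}(0)=0$. If $0<a<1$, then $P$ satisfies (i) if and only if it satisfies (ii), if and only if $x\mapsto e^{-\frac{x^2}{2a}+\psi(x)}$ is Lebesgue integrable and $P$ has the density $$f_X(x)=\frac{e^{-\frac{x^2}{2a}+\psi(x)}}{\int_{\mathbb{R}} e^{-\frac{t^2}{2a}+\psi(t)}\,dt}$$ with respect to Lebesgue measure. When that function is integrable, this $f_X$ is indeed a probability density, so that it is the unique solution of (i) and of (ii); when it is not integrable, there is no solution. If $a=0$, then $P$ satisfies (i) if and only if it satisfies (ii), if and only if $P=\delta_0$, the unit mass at $0$. -/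

import Mathlib

open MeasureTheory

noncomputable section

namespace NatExpFamily

/-- The conditional density `f(y | x) = h(y) exp (x y - ψ(x))` of `Y` given `X = x`. -/
def condDensity (h ψ : ℝ → ℝ) (x y : ℝ) : ℝ :=
  h y * Real.exp (x * y - ψ x)

/-- `h : ℝ → [0, ∞)` and `ψ : ℝ → ℝ` are the base measure and the log-partition function of a
natural exponential family with natural parameter space `ℝ`: for every `x`, the function
`y ↦ h(y) exp (x y - ψ(x))` is a probability density with respect to Lebesgue measure. -/
structure IsNaturalExponentialFamily (h ψ : ℝ → ℝ) : Prop where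
  measurable_base : Measurable h
  base_nonneg : ∀ y, 0 ≤ h y
  lintegral_eq_one : ∀ x, ∫⁻ y, ENNReal.ofReal (condDensity h ψ x y) = 1

/-- The density `f_Y(y) = ∫ f(y | x) P(dx)` of `Y` when `X` has prior law `P`. -/
def marginalDensity (h ψ : ℝ → ℝ) (P : Measure ℝ) (y : ℝ) : ENNReal :=
  ∫⁻ x, ENNReal.ofReal (condDensity h ψ x y) ∂P

/-- The conditional law of `X` given `Y = y` (Bayes' formula), for prior law `P`:
`P_{X | Y = y}(dx) = f(y | x) / f_Y(y) P(dx)`. It is meaningful when `f_Y(y)` is not zero. -/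
def posteriorLaw (h ψ : ℝ → ℝ) (P : Measure ℝ) (y : ℝ) : Measure ℝ :=
  P.withDensity fun x => ENNReal.ofReal (condDensity h ψ x y) / marginalDensity h ψ P y

/-- The quantile function `F⁻¹(p) = inf {x | p ≤ F(x)}` of a law on `ℝ` with cdf `F`. -/
def quantile (μ : Measure ℝ) (p : ℝ) : ℝ :=
  sInf {x : ℝ | p ≤ ProbabilityTheory.cdf μ x}

/-- The conditional median of `X` given `Y = y`. -/
def condMedian (h ψ : ℝ → ℝ) (P : Measure ℝ) (y : ℝ) : ℝ :=
  quantile (posteriorLaw h ψ P y) (1 / 2)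

/-- The conditional median of `X` given `Y = y` equals `a y`, for every `y` at which the
conditional law of `X` given `Y = y` is defined, that is, with `f_Y(y) ≠ 0`. -/
def HasLinearMedian (h ψ : ℝ → ℝ) (P : Measure ℝ) (a : ℝ) : Prop :=
  ∀ y : ℝ, marginalDensity h ψ P y ≠ 0 → condMedian h ψ P y = a * y

/-- The condition `E [sign (X - a y) h(y) exp (X y - ψ(X))] = 0` for all `y`, where `X` has
law `P`. -/
def SignCondition (h ψ : ℝ → ℝ) (P : Measure ℝ) (a : ℝ) : Prop :=
  ∀ y : ℝ,
    Integrable (fun x => Real.sign (x - a * y) * (h y * Real.exp (x * y - ψ x))) P ∧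
    ∫ x, Real.sign (x - a * y) * (h y * Real.exp (x * y - ψ x)) ∂P = 0

/-- The function `exp (-x² / (2 a) + ψ(x))`. -/
def priorWeight (ψ : ℝ → ℝ) (a x : ℝ) : ℝ :=
  Real.exp (-x ^ 2 / (2 * a) + ψ x)

/-- The law on `ℝ` with Lebesgue density proportional to `exp (-x² / (2 a) + ψ(x))`, normalised
to total mass one (when that function is integrable). -/
def matchingPrior (ψ : ℝ → ℝ) (a : ℝ) : Measure ℝ :=
  volume.withDensity fun x => ENNReal.ofReal (priorWeight ψ a x / ∫ t, priorWeight ψ a t)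

end NatExpFamily

end

/-! Completing the square for a > 0 gives exp(xy - ψ(x)) = exp(a y²/2) exp(-(x - ay)²/(2a))
exp(x²/(2a) - ψ(x)). With ν = exp(x²/(2a) - ψ) P and b = 1/(2a), the median condition says that, for
every t, the Gaussian exp(-b(x - t)²) gives ν equal mass on both sides of t. The point is that such
a ν is c times Lebesgue measure (`eq_smul_volume_of_balance`); normalising P then forces both
integrability and the formula.

Differentiating the balance in t gives ν = κ * ν, where κ(u) = b|u| exp(-b u²) is a probability
density; `mass_identity` is the integrated form. So ν has a density g with g = κ * g a.e. As g may
be unbounded, the argument passes to q = exp(-g), which lies in (0, 1], and Jensen gives q ≤ κ * q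
a.e. Hence R(t) = ∫ sign(u) exp(-b u²) q(t + u) du is monotone. Its integrals over intervals are
bounded because the odd kernel has mean zero, so R = 0. Thus q dx is balanced too, q = κ * q a.e.,
and equality in Jensen makes g constant.

Conversely, the matching prior has posteriors proportional to a Gaussian centred at ay. For a = 0,
letting y → ±∞ within {h > 0} makes any mass of P off 0 dominate one side, so P = δ₀. -/

open scoped ENNReal Topology
open Set Filter

/-! ### Gaussian balance and the convolution equation ν = κ * ν. -/

namespace GaussianBalance

/-- The Gaussian kernel `exp (-b u²)`. -/
noncomputable def gaussKernel (b u : ℝ) : ℝ≥0∞ := ENNReal.ofReal (Real.exp (-b * u ^ 2))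

/-- The two-sided Rayleigh density `b |u| exp (-b u²)`. -/
noncomputable def rayleigh (b u : ℝ) : ℝ≥0∞ := ENNReal.ofReal (b * |u| * Real.exp (-b * u ^ 2))

/-- The mass that the Gaussian kernel centred at `t` gives to `ν` on the right of `t`. -/
noncomputable def upperMass (b : ℝ) (ν : Measure ℝ) (t : ℝ) : ℝ≥0∞ :=
  ∫⁻ x in Ioi t, gaussKernel b (x - t) ∂ν

/-- The mass that the Gaussian kernel centred at `t` gives to `ν` on the left of `t`. -/
noncomputable def lowerMass (b : ℝ) (ν : Measure ℝ) (t : ℝ) : ℝ≥0∞ :=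
  ∫⁻ x in Iic t, gaussKernel b (x - t) ∂ν

/-- The convolution of `ν` with the Rayleigh density. -/
noncomputable def rayleighConv (b : ℝ) (ν : Measure ℝ) (t : ℝ) : ℝ≥0∞ :=
  ∫⁻ x, rayleigh b (x - t) ∂ν

@[fun_prop]
lemma measurable_gaussKernel (b : ℝ) : Measurable (gaussKernel b) := by
  unfold gaussKernel; fun_prop

@[fun_prop]
lemma measurable_rayleigh (b : ℝ) : Measurable (rayleigh b) := by
  unfold rayleigh; fun_prop

lemma measurable_rayleighConv (b : ℝ) (ν : Measure ℝ) [SFinite ν] :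
    Measurable (rayleighConv b ν) := by
  unfold rayleighConv
  exact Measurable.lintegral_prod_right' (f := fun p : ℝ × ℝ => rayleigh b (p.2 - p.1))
    (by fun_prop)

lemma hasDerivAt_gauss (b x s : ℝ) :
    HasDerivAt (fun s => Real.exp (-b * (x - s) ^ 2) / 2)
      (b * (x - s) * Real.exp (-b * (x - s) ^ 2)) s := by
  have h1 : HasDerivAt (fun s => -b * (x - s) ^ 2) (2 * b * (x - s)) s := by
    have := (((hasDerivAt_id s).const_sub x).pow 2).const_mul (-b)
    refine this.congr_deriv ?_
    simp
    ring
  refine (h1.exp.div_const 2).congr_deriv ?_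
  ring

lemma intervalIntegral_rayleigh_left (b x : ℝ) {t₀ t : ℝ} (h₀ : x ≤ t₀) (h : t₀ ≤ t) :
    ∫ s in t₀..t, b * |x - s| * Real.exp (-b * (x - s) ^ 2) =
      Real.exp (-b * (x - t₀) ^ 2) / 2 - Real.exp (-b * (x - t) ^ 2) / 2 := by
  rw [intervalIntegral.integral_congr
    (g := fun s => -(b * (x - s) * Real.exp (-b * (x - s) ^ 2)))]
  · rw [intervalIntegral.integral_neg, intervalIntegral.integral_eq_sub_of_hasDerivAt
      (fun s _ => hasDerivAt_gauss b x s) (Continuous.intervalIntegrable (by fun_prop) _ _)]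
    ring
  · intro s hs
    rw [uIcc_of_le h] at hs
    have : |x - s| = -(x - s) := abs_of_nonpos (by linarith [hs.1])
    simp only [this]; ring

lemma intervalIntegral_rayleigh_right (b x : ℝ) {t₀ t : ℝ} (h₀ : t ≤ x) (h : t₀ ≤ t) :
    ∫ s in t₀..t, b * |x - s| * Real.exp (-b * (x - s) ^ 2) =
      Real.exp (-b * (x - t) ^ 2) / 2 - Real.exp (-b * (x - t₀) ^ 2) / 2 := by
  rw [intervalIntegral.integral_congr
    (g := fun s => b * (x - s) * Real.exp (-b * (x - s) ^ 2))]
  · rw [intervalIntegral.integral_eq_sub_of_hasDerivAt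
      (fun s _ => hasDerivAt_gauss b x s) (Continuous.intervalIntegrable (by fun_prop) _ _)]
  · intro s hs
    rw [uIcc_of_le h] at hs
    have : |x - s| = x - s := abs_of_nonneg (by linarith [hs.2])
    simp only [this]

lemma lintegral_rayleigh_Ioc {b : ℝ} (hb : 0 ≤ b) (x : ℝ) {t₀ t : ℝ} (h : t₀ ≤ t) :
    ∫⁻ s in Ioc t₀ t, rayleigh b (x - s) =
      ENNReal.ofReal (∫ s in t₀..t, b * |x - s| * Real.exp (-b * (x - s) ^ 2)) := by
  rw [intervalIntegral.integral_of_le h, ofReal_integral_eq_lintegral_ofReal]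
  · rfl
  · exact (Continuous.integrableOn_Icc (by fun_prop)).mono_set Ioc_subset_Icc_self
  · exact Eventually.of_forall fun s => by positivity

/-- The integrated form of the identity `d/ds [sign (x - s) exp (-b (x - s)²)] = 2 κ(x - s) - 2 δ_x`,
where `κ` is the Rayleigh density. -/
lemma kernel_identity {b : ℝ} (hb : 0 ≤ b) (x : ℝ) {t₀ t : ℝ} (h : t₀ ≤ t) :
    (Ioi t₀).indicator (fun x => gaussKernel b (x - t₀)) x +
      (Iic t).indicator (fun x => gaussKernel b (x - t)) x +
      2 * ∫⁻ s in Ioc t₀ t, rayleigh b (x - s) =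
    2 * (Ioc t₀ t).indicator 1 x + (Ioi t).indicator (fun x => gaussKernel b (x - t)) x +
      (Iic t₀).indicator (fun x => gaussKernel b (x - t₀)) x := by
  have two : (2 : ℝ≥0∞) = ENNReal.ofReal 2 := by simp
  rw [lintegral_rayleigh_Ioc hb x h]
  have hint : 0 ≤ ∫ s in t₀..t, b * |x - s| * Real.exp (-b * (x - s) ^ 2) :=
    intervalIntegral.integral_nonneg h fun s _ => by positivity
  have e0 := Real.exp_pos (-b * (x - t₀) ^ 2)
  have e1 := Real.exp_pos (-b * (x - t) ^ 2)
  rcases le_or_gt x t₀ with hx | hx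
  · have := intervalIntegral_rayleigh_left b x hx h
    rw [indicator_of_notMem (by simpa using hx), indicator_of_mem (by simpa using hx.trans h),
      indicator_of_notMem (show x ∉ Ioc t₀ t from fun h' => absurd h'.1 (not_lt.2 hx)),
      indicator_of_notMem (by simpa using hx.trans h), indicator_of_mem (by simpa using hx)]
    simp only [gaussKernel, mul_zero, zero_add]
    rw [two, ← ENNReal.ofReal_mul (by norm_num), ← ENNReal.ofReal_add e1.le (by positivity), this]
    congr 1; ring
  rcases lt_or_ge t x with hx' | hx'
  · have := intervalIntegral_rayleigh_right b x hx'.le h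
    rw [indicator_of_mem (by simpa using hx), indicator_of_notMem (by simpa using hx'),
      indicator_of_notMem (show x ∉ Ioc t₀ t from fun h' => absurd h'.2 (not_le.2 hx')),
      indicator_of_mem (by simpa using hx'), indicator_of_notMem (by simpa using hx)]
    simp only [gaussKernel, mul_zero, zero_add, add_zero]
    rw [two, ← ENNReal.ofReal_mul (by norm_num), ← ENNReal.ofReal_add e0.le (by positivity), this]
    congr 1; ring
  -- For x in (t₀, t] the integral is split at the kink s = x. Each half contributes exp(0)/2 there,
  -- and these produce the term 2 carried by the indicator of (t₀, t].
  · have h1 := intervalIntegral_rayleigh_right b x le_rfl hx.le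
    have h2 := intervalIntegral_rayleigh_left b x le_rfl hx'
    have hi : ∀ c d : ℝ, IntervalIntegrable
        (fun s => b * |x - s| * Real.exp (-b * (x - s) ^ 2)) volume c d :=
      fun c d => Continuous.intervalIntegrable (by fun_prop) _ _
    have h3 := intervalIntegral.integral_add_adjacent_intervals (hi t₀ x) (hi x t)
    rw [indicator_of_mem (by simpa using hx), indicator_of_mem (by simpa using hx'),
      indicator_of_mem (show x ∈ Ioc t₀ t from ⟨hx, hx'⟩),
      indicator_of_notMem (by simpa using hx'), indicator_of_notMem (by simpa using hx)]
    simp only [gaussKernel, add_zero, Pi.one_apply, mul_one]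
    rw [two, ← ENNReal.ofReal_mul (by norm_num), ← ENNReal.ofReal_add e0.le e1.le,
      ← ENNReal.ofReal_add (by positivity) (by positivity), ← h3, h1, h2]
    congr 1
    simp
    ring

/-- Integrate `kernel_identity` against ν and apply Tonelli. All terms are placed with positive
sign, so no finiteness is needed. -/
lemma mass_identity {b : ℝ} (hb : 0 ≤ b) (ν : Measure ℝ) [SFinite ν] {t₀ t : ℝ} (h : t₀ ≤ t) :
    upperMass b ν t₀ + lowerMass b ν t + 2 * ∫⁻ s in Ioc t₀ t, rayleighConv b ν s =
      2 * ν (Ioc t₀ t) + upperMass b ν t + lowerMass b ν t₀ := by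
  have key := lintegral_congr (μ := ν) fun x => kernel_identity hb x h
  have m (s : ℝ) : Measurable fun x => gaussKernel b (x - s) := by fun_prop
  have m' : Measurable (fun x => ∫⁻ s in Ioc t₀ t, rayleigh b (x - s)) :=
    Measurable.lintegral_prod_right' (f := fun p : ℝ × ℝ => rayleigh b (p.1 - p.2)) (by fun_prop)
  have mi (s : ℝ) := (m s).indicator (measurableSet_Ioi (a := s))
  have mj (s : ℝ) := (m s).indicator (measurableSet_Iic (a := s))
  rw [lintegral_add_right _ (m'.const_mul 2), lintegral_add_left (mi t₀),
    lintegral_const_mul _ m', lintegral_add_right _ (mj t₀), lintegral_add_right _ (mi t),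
    lintegral_const_mul _ (measurable_one.indicator measurableSet_Ioc),
    lintegral_indicator_one measurableSet_Ioc] at key
  simp only [lintegral_indicator measurableSet_Ioi, lintegral_indicator measurableSet_Iic] at key
  rw [lintegral_lintegral_swap (by fun_prop)] at key
  exact key

/-- The Gaussian centred at t is at least exp(-b) on [t - 1, t + 1]. -/
lemma isLocallyFiniteMeasure_of_mass_ne_top {b : ℝ} (hb : 0 ≤ b) {ν : Measure ℝ}
    (hu : ∀ t, upperMass b ν t ≠ ∞) (hl : ∀ t, lowerMass b ν t ≠ ∞) :
    IsLocallyFiniteMeasure ν := by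
  refine ⟨fun t => ⟨Icc (t - 1) (t + 1), Icc_mem_nhds (by linarith) (by linarith), ?_⟩⟩
  have h1 : ENNReal.ofReal (Real.exp (-b)) * ν (Icc (t - 1) (t + 1)) ≤
      lowerMass b ν t + upperMass b ν t := by
    have : lowerMass b ν t + upperMass b ν t = ∫⁻ x, gaussKernel b (x - t) ∂ν := by
      rw [← lintegral_add_compl _ (measurableSet_Iic (a := t)), compl_Iic]; rfl
    rw [this, ← setLIntegral_const]
    refine (setLIntegral_mono (by fun_prop) fun x hx => ?_).trans (setLIntegral_le_lintegral _ _)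
    refine ENNReal.ofReal_le_ofReal (Real.exp_le_exp.2 ?_)
    have : (x - t) ^ 2 ≤ 1 := by nlinarith [hx.1, hx.2]
    nlinarith
  have h2 := h1.trans_lt (ENNReal.add_lt_top.2 ⟨(hl t).lt_top, (hu t).lt_top⟩)
  rcases ENNReal.mul_lt_top_iff.1 h2 with h | h | h
  · exact h.2
  · exact absurd h (by simpa using Real.exp_pos (-b))
  · simp [h]

/-- Under balance the four one-sided masses in `mass_identity` cancel, leaving equality on every
half-open interval; in particular ν has no atoms. -/
lemma eq_withDensity_of_balance {b : ℝ} (hb : 0 ≤ b) {ν : Measure ℝ}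
    (hl : ∀ t, lowerMass b ν t ≠ ∞) (hbal : ∀ t, upperMass b ν t = lowerMass b ν t) :
    ν = volume.withDensity (rayleighConv b ν) := by
  have := isLocallyFiniteMeasure_of_mass_ne_top hb (fun t => hbal t ▸ hl t) hl
  refine Measure.ext_of_Ioc _ _ fun c d hcd => ?_
  rw [withDensity_apply _ measurableSet_Ioc]
  have h := mass_identity hb ν hcd.le
  rw [hbal, hbal, add_assoc (2 * _), add_comm (2 * _), add_comm (lowerMass b ν d)] at h
  have h' := (ENNReal.add_right_inj (ENNReal.add_ne_top.2 ⟨hl c, hl d⟩)).1 h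
  exact ((ENNReal.mul_right_inj (by simp) (by simp)).1 h').symm

lemma integrable_gauss {b : ℝ} (hb : 0 < b) : Integrable fun u : ℝ => Real.exp (-b * u ^ 2) :=
  integrable_exp_neg_mul_sq hb

lemma integrable_rayleigh {b : ℝ} (hb : 0 < b) :
    Integrable fun u : ℝ => b * |u| * Real.exp (-b * u ^ 2) := by
  have := ((integrable_mul_exp_neg_mul_sq hb).norm.const_mul b)
  refine this.congr (Eventually.of_forall fun u => ?_)
  simp [abs_of_pos (Real.exp_pos _)]
  ring

lemma integral_rayleigh {b : ℝ} (hb : 0 < b) :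
    ∫ u : ℝ, b * |u| * Real.exp (-b * u ^ 2) = 1 := by
  have h := integral_comp_abs (f := fun u => b * u * Real.exp (-b * u ^ 2))
  simp only [sq_abs] at h
  rw [h]
  have h3 : ∫ u in Ioi (0 : ℝ), b * u * Real.exp (-b * u ^ 2) = 0 - -(1 / 2) := by
    refine integral_Ioi_of_hasDerivAt_of_tendsto' (f := fun u => -(Real.exp (-b * u ^ 2) / 2))
      (m := 0) (a := 0) ?_ ?_ ?_ |>.trans (by simp)
    · intro u _
      have h1 : HasDerivAt (fun s : ℝ => -b * s ^ 2) (-(2 * b * u)) u := by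
        refine ((hasDerivAt_pow 2 u).const_mul (-b)).congr_deriv ?_
        simp
        ring
      refine (h1.exp.div_const 2).neg.congr_deriv ?_
      ring
    · refine (((integrable_mul_exp_neg_mul_sq hb).const_mul b).congr
        (Eventually.of_forall fun u => ?_)).integrableOn
      simp only
      ring
    · have h1 : Tendsto (fun u : ℝ => -b * u ^ 2) atTop atBot :=
        (tendsto_pow_atTop two_ne_zero).const_mul_atTop_of_neg (by linarith)
      simpa using ((Real.tendsto_exp_atBot.comp h1).div_const 2).neg
  rw [h3]
  norm_num

end GaussianBalance

/-! ### Bounded densities with q ≤ κ * q are balanced. -/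

namespace GaussianBalance

/-- The odd kernel `± exp (-b u²)`. -/
noncomputable def oddKernel (b u : ℝ) : ℝ :=
  if 0 < u then Real.exp (-b * u ^ 2) else -Real.exp (-b * u ^ 2)

lemma measurable_oddKernel (b : ℝ) : Measurable (oddKernel b) :=
  Measurable.ite measurableSet_Ioi (by fun_prop) (by fun_prop)

lemma abs_oddKernel (b u : ℝ) : |oddKernel b u| = Real.exp (-b * u ^ 2) := by
  unfold oddKernel
  split_ifs <;> simp

lemma integrable_oddKernel {b : ℝ} (hb : 0 < b) : Integrable (oddKernel b) :=
  (integrable_gauss hb).mono' (measurable_oddKernel b).aestronglyMeasurable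
    (Eventually.of_forall fun u => (abs_oddKernel b u).le)

lemma integral_oddKernel (b : ℝ) : ∫ u, oddKernel b u = 0 := by
  have h : ∫ u, oddKernel b (-u) = -∫ u, oddKernel b u := by
    rw [← integral_neg]
    refine integral_congr_ae ?_
    filter_upwards [compl_mem_ae_iff.2 (measure_singleton (0 : ℝ))] with u hu
    rcases lt_or_gt_of_ne (show u ≠ 0 from hu) with h | h
    · simp [oddKernel, h, h.not_gt]
    · simp [oddKernel, h, h.le]
  rw [integral_neg_eq_self (oddKernel b)] at h
  linarith

variable {b : ℝ} {q : ℝ → ℝ}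

lemma integrable_oddKernel_mul (hb : 0 < b) (hq : Measurable q) (hq0 : ∀ x, 0 ≤ q x)
    (hq1 : ∀ x, q x ≤ 1) (t : ℝ) : Integrable fun u => oddKernel b u * q (t + u) := by
  refine (integrable_gauss hb).mono'
    ((measurable_oddKernel b).mul (by fun_prop)).aestronglyMeasurable
    (Eventually.of_forall fun u => ?_)
  rw [norm_mul, Real.norm_eq_abs, abs_oddKernel, Real.norm_of_nonneg (hq0 _)]
  exact mul_le_of_le_one_right (Real.exp_pos _).le (hq1 _)

/-- Shifting the window changes only two end pieces of length |u|, on which 0 ≤ q ≤ 1. -/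
lemma abs_integral_shift_sub_le (hq : Measurable q) (hq0 : ∀ x, 0 ≤ q x)
    (hq1 : ∀ x, q x ≤ 1) (c d u : ℝ) :
    |(∫ t in c..d, q (t + u)) - ∫ t in c..d, q t| ≤ 2 * |u| := by
  have hi (x y : ℝ) : IntervalIntegrable q volume x y := by
    refine (intervalIntegrable_const (c := (1 : ℝ))).mono_fun' hq.aestronglyMeasurable ?_
    exact Eventually.of_forall fun x => by
      simpa only [Real.norm_of_nonneg (hq0 x)] using hq1 x
  have hb (x y : ℝ) : ‖∫ t in x..y, q t‖ ≤ 1 * |y - x| :=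
    intervalIntegral.norm_integral_le_of_norm_le_const fun x _ => by
      simpa only [Real.norm_of_nonneg (hq0 x)] using hq1 x
  rw [intervalIntegral.integral_comp_add_right,
    intervalIntegral.integral_interval_sub_interval_comm (hi _ _) (hi _ _) (hi _ _)]
  have h1 := hb (c + u) c
  have h2 := hb (d + u) d
  rw [sub_add_cancel_left, abs_neg, one_mul, Real.norm_eq_abs] at h1 h2
  rw [← Real.norm_eq_abs]
  refine (norm_sub_le _ _).trans ?_
  rw [Real.norm_eq_abs, Real.norm_eq_abs]
  linarith

/-- After Fubini, the unshifted integral of q can be subtracted for free because the odd kernel has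
mean zero. What remains is at most ∫ 2|u| exp(-b u²) du = 2/b, uniformly in the interval. -/
lemma abs_integral_balance_le (hb : 0 < b) (hq : Measurable q) (hq0 : ∀ x, 0 ≤ q x)
    (hq1 : ∀ x, q x ≤ 1) {c d : ℝ} (hcd : c ≤ d) :
    |∫ t in c..d, ∫ u, oddKernel b u * q (t + u)| ≤ 2 / b := by
  have hsw : ∫ t in c..d, ∫ u, oddKernel b u * q (t + u) =
      ∫ u, ∫ t in c..d, oddKernel b u * q (t + u) := by
    simp only [intervalIntegral.integral_of_le hcd]
    refine integral_integral_swap ?_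
    have hg : Integrable (fun p : ℝ × ℝ => (1 : ℝ) * Real.exp (-b * p.2 ^ 2))
        ((volume.restrict (Ioc c d)).prod volume) :=
      (integrable_const (1 : ℝ)).mul_prod (integrable_gauss hb)
    refine hg.mono' ?_ (Eventually.of_forall fun p => ?_)
    · refine Measurable.aestronglyMeasurable ?_
      exact ((measurable_oddKernel b).comp measurable_snd).mul
        (hq.comp (measurable_fst.add measurable_snd))
    · simp only [Function.uncurry]
      rw [norm_mul, Real.norm_eq_abs, abs_oddKernel, Real.norm_of_nonneg (hq0 _), one_mul]
      exact mul_le_of_le_one_right (Real.exp_pos _).le (hq1 _)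
  have hz : ∫ u, oddKernel b u * ∫ t in c..d, q t = 0 := by
    rw [integral_mul_const, integral_oddKernel, zero_mul]
  have hint : Integrable fun u => 2 / b * (b * |u| * Real.exp (-b * u ^ 2)) :=
    (integrable_rayleigh hb).const_mul _
  have hdom (u : ℝ) : ‖oddKernel b u * ((∫ t in c..d, q (t + u)) - ∫ t in c..d, q t)‖ ≤
      2 / b * (b * |u| * Real.exp (-b * u ^ 2)) := by
    rw [norm_mul, Real.norm_eq_abs, abs_oddKernel, Real.norm_eq_abs]
    calc _ ≤ Real.exp (-b * u ^ 2) * (2 * |u|) := by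
          gcongr
          exact abs_integral_shift_sub_le hq hq0 hq1 c d u
      _ = _ := by field_simp
  have hm : Measurable fun u => ∫ t in c..d, q (t + u) := by
    simp only [intervalIntegral.integral_of_le hcd]
    exact (StronglyMeasurable.integral_prod_right
      (f := fun u t : ℝ => q (t + u)) (by
        exact (hq.comp (measurable_snd.add measurable_fst)).stronglyMeasurable)).measurable
  have hi : Integrable fun u =>
      oddKernel b u * ((∫ t in c..d, q (t + u)) - ∫ t in c..d, q t) :=
    hint.mono' ((measurable_oddKernel b).mul (hm.sub_const _)).aestronglyMeasurable
      (Eventually.of_forall hdom)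
  have hsplit : ∫ u, ∫ t in c..d, oddKernel b u * q (t + u) =
      ∫ u, oddKernel b u * ((∫ t in c..d, q (t + u)) - ∫ t in c..d, q t) := by
    rw [← add_zero (∫ u, oddKernel b u * _), ← hz,
      ← integral_add hi ((integrable_oddKernel hb).mul_const _)]
    refine integral_congr_ae (Eventually.of_forall fun u => ?_)
    simp only [intervalIntegral.integral_const_mul]
    ring
  rw [hsw, hsplit]
  calc _ ≤ ∫ u, 2 / b * (b * |u| * Real.exp (-b * u ^ 2)) :=
        norm_integral_le_of_norm_le hint (Eventually.of_forall hdom)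
    _ = 2 / b := by rw [integral_const_mul, integral_rayleigh hb, mul_one]

/-- A positive value persists to the right and a negative one to the left, so over long intervals
the integral would exceed C in absolute value. -/
lemma eq_zero_of_monotone_of_integral_bounded {R : ℝ → ℝ} (hR : Monotone R) {C : ℝ}
    (hC : ∀ c d, c ≤ d → |∫ t in c..d, R t| ≤ C) (t : ℝ) : R t = 0 := by
  have hC0 : 0 ≤ C := (abs_nonneg _).trans (hC 0 0 le_rfl)
  have h1 (N : ℝ) (hN : 0 ≤ N) : N * R t ≤ C := by
    have := intervalIntegral.integral_mono_on (a := t) (b := t + N) (by linarith)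
      (intervalIntegrable_const (μ := volume) (c := R t)) hR.intervalIntegrable fun x hx => hR hx.1
    rw [intervalIntegral.integral_const, smul_eq_mul, add_sub_cancel_left] at this
    exact this.trans ((le_abs_self _).trans (hC _ _ (by linarith)))
  have h2 (N : ℝ) (hN : 0 ≤ N) : -C ≤ N * R t := by
    have := intervalIntegral.integral_mono_on (a := t - N) (b := t) (by linarith)
      hR.intervalIntegrable (intervalIntegrable_const (μ := volume) (c := R t)) fun x hx => hR hx.2
    rw [intervalIntegral.integral_const, smul_eq_mul, sub_sub_cancel] at this
    exact (neg_le_of_abs_le (hC _ _ (by linarith))).trans this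
  rcases lt_trichotomy (R t) 0 with h | h | h
  · have := h2 ((C + 1) / -R t) (by have := neg_pos.2 h; positivity)
    have h3 : (C + 1) / -R t * R t = -(C + 1) := by
      rw [div_neg, neg_mul, div_mul_cancel₀ _ h.ne]
    linarith
  · exact h
  · have := h1 ((C + 1) / R t) (by positivity)
    have h3 : (C + 1) / R t * R t = C + 1 := by field_simp
    linarith

lemma upperMass_withDensity (hq : Measurable q) (t : ℝ) :
    upperMass b (volume.withDensity fun x => ENNReal.ofReal (q x)) t =
      ∫⁻ u in Ioi 0, ENNReal.ofReal (Real.exp (-b * u ^ 2) * q (t + u)) := by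
  unfold upperMass
  rw [restrict_withDensity measurableSet_Ioi, lintegral_withDensity_eq_lintegral_mul _
    (by fun_prop) (by fun_prop)]
  rw [← lintegral_indicator measurableSet_Ioi, ← lintegral_indicator measurableSet_Ioi,
    ← lintegral_add_left_eq_self _ t]
  refine lintegral_congr fun u => ?_
  by_cases hu : 0 < u
  · rw [indicator_of_mem (by simpa using hu), indicator_of_mem (by simpa using hu)]
    rw [Pi.mul_apply, gaussKernel, add_sub_cancel_left, mul_comm,
      ENNReal.ofReal_mul (Real.exp_pos _).le]
  · rw [indicator_of_notMem (by simpa using hu), indicator_of_notMem (by simpa using hu)]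

lemma lowerMass_withDensity (hq : Measurable q) (t : ℝ) :
    lowerMass b (volume.withDensity fun x => ENNReal.ofReal (q x)) t =
      ∫⁻ u in Iic 0, ENNReal.ofReal (Real.exp (-b * u ^ 2) * q (t + u)) := by
  unfold lowerMass
  rw [restrict_withDensity measurableSet_Iic, lintegral_withDensity_eq_lintegral_mul _
    (by fun_prop) (by fun_prop)]
  rw [← lintegral_indicator measurableSet_Iic, ← lintegral_indicator measurableSet_Iic,
    ← lintegral_add_left_eq_self _ t]
  refine lintegral_congr fun u => ?_
  by_cases hu : u ≤ 0
  · rw [indicator_of_mem (by simpa using hu), indicator_of_mem (by simpa using hu)]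
    rw [Pi.mul_apply, gaussKernel, add_sub_cancel_left, mul_comm,
      ENNReal.ofReal_mul (Real.exp_pos _).le]
  · rw [indicator_of_notMem (by simpa using hu), indicator_of_notMem (by simpa using hu)]

lemma balance_of_le_rayleighConv (hb : 0 < b) (hq : Measurable q) (hq0 : ∀ x, 0 ≤ q x)
    (hq1 : ∀ x, q x ≤ 1)
    (hle : ∀ᵐ s, ENNReal.ofReal (q s) ≤
      rayleighConv b (volume.withDensity fun x => ENNReal.ofReal (q x)) s) (t : ℝ) :
    upperMass b (volume.withDensity fun x => ENNReal.ofReal (q x)) t =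
      lowerMass b (volume.withDensity fun x => ENNReal.ofReal (q x)) t ∧
    lowerMass b (volume.withDensity fun x => ENNReal.ofReal (q x)) t ≠ ∞ := by
  set ν := volume.withDensity fun x => ENNReal.ofReal (q x) with hν
  have hi (t : ℝ) : Integrable fun u => Real.exp (-b * u ^ 2) * q (t + u) := by
    refine (integrable_oddKernel_mul hb hq hq0 hq1 t).norm.congr (Eventually.of_forall fun u => ?_)
    simp only
    rw [norm_mul, Real.norm_eq_abs, abs_oddKernel, Real.norm_of_nonneg (hq0 _)]
  have hpos (t u : ℝ) : 0 ≤ Real.exp (-b * u ^ 2) * q (t + u) :=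
    mul_nonneg (Real.exp_pos _).le (hq0 _)
  have hU (t : ℝ) : upperMass b ν t =
      ENNReal.ofReal (∫ u in Ioi 0, Real.exp (-b * u ^ 2) * q (t + u)) := by
    rw [hν, upperMass_withDensity hq,
      ofReal_integral_eq_lintegral_ofReal (hi t).integrableOn (Eventually.of_forall (hpos t))]
  have hL (t : ℝ) : lowerMass b ν t =
      ENNReal.ofReal (∫ u in Iic 0, Real.exp (-b * u ^ 2) * q (t + u)) := by
    rw [hν, lowerMass_withDensity hq,
      ofReal_integral_eq_lintegral_ofReal (hi t).integrableOn (Eventually.of_forall (hpos t))]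
  have hR (t : ℝ) : ∫ u, oddKernel b u * q (t + u) =
      (upperMass b ν t).toReal - (lowerMass b ν t).toReal := by
    rw [hU, hL, ENNReal.toReal_ofReal (integral_nonneg (hpos t)),
      ENNReal.toReal_ofReal (integral_nonneg (hpos t)),
      ← integral_add_compl (measurableSet_Ioi (a := (0 : ℝ)))
        (integrable_oddKernel_mul hb hq hq0 hq1 t), compl_Ioi, sub_eq_add_neg, ← integral_neg]
    congr 1
    · refine setIntegral_congr_fun measurableSet_Ioi fun u hu => ?_
      have : 0 < u := hu
      simp [oddKernel, this]
    · refine setIntegral_congr_fun measurableSet_Iic fun u hu => ?_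
      have : ¬ 0 < u := not_lt.2 hu
      simp [oddKernel, this]
  have hUt (t : ℝ) : upperMass b ν t ≠ ∞ := hU t ▸ ENNReal.ofReal_ne_top
  have hLt (t : ℝ) : lowerMass b ν t ≠ ∞ := hL t ▸ ENNReal.ofReal_ne_top
  -- By `mass_identity` the increment over (s, t] is twice the integral of κ * q - q, which is
  -- nonnegative by `hle`.
  have hmono : Monotone fun t => ∫ u, oddKernel b u * q (t + u) := by
    intro s t hst
    have h1 := mass_identity hb.le ν hst
    have h2 : ν (Ioc s t) ≤ ∫⁻ x in Ioc s t, rayleighConv b ν x := by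
      rw [hν, withDensity_apply _ measurableSet_Ioc]
      exact lintegral_mono_ae (ae_restrict_of_ae hle)
    have h3 : ν (Ioc s t) ≠ ∞ := by
      have := isLocallyFiniteMeasure_of_mass_ne_top hb.le hUt hLt
      exact measure_Ioc_lt_top.ne
    have h4 : upperMass b ν s + lowerMass b ν t ≤ upperMass b ν t + lowerMass b ν s := by
      have h5 : upperMass b ν s + lowerMass b ν t + 2 * ν (Ioc s t) ≤
          upperMass b ν t + lowerMass b ν s + 2 * ν (Ioc s t) := by
        calc _ ≤ _ := by gcongr
          _ = _ := h1
          _ = _ := by ring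
      exact (ENNReal.add_le_add_iff_right (ENNReal.mul_ne_top (by simp) h3)).1 h5
    have h6 := ENNReal.toReal_mono (ENNReal.add_ne_top.2 ⟨hUt t, hLt s⟩) h4
    rw [ENNReal.toReal_add (hUt s) (hLt t), ENNReal.toReal_add (hUt t) (hLt s)] at h6
    simp only [hR]
    linarith
  have h0 := eq_zero_of_monotone_of_integral_bounded hmono
    (fun c d hcd => abs_integral_balance_le hb hq hq0 hq1 hcd) t
  refine ⟨(ENNReal.toReal_eq_toReal_iff' (hUt t) (hLt t)).1 ?_, hLt t⟩
  simp only [hR] at h0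
  linarith

end GaussianBalance

/-! ### Jensen's inequality and uniqueness of the balanced measure. -/

namespace GaussianBalance

variable {b : ℝ}

lemma rayleighConv_withDensity {g : ℝ → ℝ≥0∞} (hg : Measurable g) (s : ℝ) :
    rayleighConv b (volume.withDensity g) s = ∫⁻ x, rayleigh b (x - s) * g x := by
  unfold rayleighConv
  rw [lintegral_withDensity_eq_lintegral_mul _ hg (by fun_prop)]
  simp only [Pi.mul_apply, mul_comm]

lemma ae_ne_top_of_isLocallyFiniteMeasure_withDensity {f : ℝ → ℝ≥0∞} (hf : Measurable f)
    [IsLocallyFiniteMeasure (volume.withDensity f)] : ∀ᵐ x, f x ≠ ∞ := by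
  have h (n : ℕ) : ∀ᵐ x, x ∈ Ioo (-(n : ℝ)) n → f x ≠ ∞ := by
    rw [← ae_restrict_iff' measurableSet_Ioo]
    have : ∫⁻ x in Ioo (-(n : ℝ)) n, f x ≠ ∞ := by
      rw [← withDensity_apply _ measurableSet_Ioo]
      exact measure_Ioo_lt_top.ne
    exact (ae_lt_top hf this).mono fun x hx => hx.ne
  filter_upwards [ae_all_iff.2 h] with x hx
  obtain ⟨n, hn⟩ := exists_nat_gt |x|
  exact hx n (abs_lt.1 hn)

/-- The gap in the tangent line inequality for `exp (-·)`, integrated against a Rayleigh density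
centred at `s`. -/
lemma exp_neg_jensen (hb : 0 < b) {g : ℝ → ℝ} (hg : Measurable g) (hg0 : ∀ x, 0 ≤ g x) {s : ℝ}
    (hint : Integrable fun x => b * |x - s| * Real.exp (-b * (x - s) ^ 2) * g x)
    (hs : ∫ x, b * |x - s| * Real.exp (-b * (x - s) ^ 2) * g x = g s) :
    Real.exp (-g s) ≤ ∫ x, b * |x - s| * Real.exp (-b * (x - s) ^ 2) * Real.exp (-g x) ∧
    (Real.exp (-g s) = ∫ x, b * |x - s| * Real.exp (-b * (x - s) ^ 2) * Real.exp (-g x) →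
      ∀ᵐ x, g x = g s) := by
  set k : ℝ → ℝ := fun x => b * |x - s| * Real.exp (-b * (x - s) ^ 2) with hk
  have hk0 (x : ℝ) : 0 ≤ k x := by positivity
  have hki : Integrable k := (integrable_rayleigh hb).comp_sub_right s
  have hk1 : ∫ x, k x = 1 :=
    (integral_sub_right_eq_self (fun u => b * |u| * Real.exp (-b * u ^ 2)) s).trans
      (integral_rayleigh hb)
  have hqi : Integrable fun x => k x * Real.exp (-g x) := by
    refine hki.mono' (by fun_prop) (Eventually.of_forall fun x => ?_)
    rw [norm_mul, Real.norm_of_nonneg (hk0 x), Real.norm_of_nonneg (Real.exp_pos _).le]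
    exact mul_le_of_le_one_right (hk0 x) (Real.exp_le_one_iff.2 (by linarith [hg0 x]))
  -- The tangent to exp(-v) at v = g s, weighted by k; its integral is exp(-g s) since k has mean
  -- one and g has k-mean g s.
  have hti : Integrable fun x => Real.exp (-g s) * ((1 + g s) * k x - k x * g x) :=
    ((hki.const_mul _).sub hint).const_mul _
  have htv : ∫ x, Real.exp (-g s) * ((1 + g s) * k x - k x * g x) = Real.exp (-g s) := by
    rw [integral_const_mul, integral_sub (hki.const_mul _) hint, integral_const_mul, hk1, hs]
    ring
  have hlt (x : ℝ) (hx : g x ≠ g s) :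
      Real.exp (-g s) * ((1 + g s) - g x) < Real.exp (-g x) := by
    have := Real.add_one_lt_exp (x := g s - g x) (sub_ne_zero.2 hx.symm)
    calc _ = Real.exp (-g s) * (g s - g x + 1) := by ring
      _ < Real.exp (-g s) * Real.exp (g s - g x) := by gcongr
      _ = _ := by rw [← Real.exp_add]; ring_nf
  have hd (x : ℝ) : Real.exp (-g s) * ((1 + g s) * k x - k x * g x) ≤
      k x * Real.exp (-g x) := by
    have : Real.exp (-g s) * ((1 + g s) - g x) ≤ Real.exp (-g x) := by
      by_cases hx : g x = g s
      · rw [hx]; simp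
      · exact (hlt x hx).le
    calc _ = k x * (Real.exp (-g s) * ((1 + g s) - g x)) := by ring
      _ ≤ _ := by gcongr
  refine ⟨by rw [← htv]; exact integral_mono hti hqi hd, fun heq => ?_⟩
  rw [← htv] at heq
  -- Equality of the integrals closes the tangent gap a.e.; k vanishes only at s, so strict
  -- convexity forces g x = g s.
  have hae := (integral_eq_iff_of_ae_le hti hqi (Eventually.of_forall hd)).1 heq
  filter_upwards [hae, compl_mem_ae_iff.2 (measure_singleton s)] with x hx hxs
  by_contra hne
  have hkx : 0 < k x := by
    have : 0 < |x - s| := abs_pos.2 (sub_ne_zero.2 hxs)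
    positivity
  have := mul_lt_mul_of_pos_left (hlt x hne) hkx
  linarith

/-- A measure to which, for every `t`, the Gaussian kernel centred at `t` gives the same finite
mass on both sides of `t` is a multiple of Lebesgue measure. -/
theorem eq_smul_volume_of_balance (hb : 0 < b) {ν : Measure ℝ}
    (hl : ∀ t, lowerMass b ν t ≠ ∞) (hbal : ∀ t, upperMass b ν t = lowerMass b ν t) :
    ∃ c : ℝ≥0∞, ν = c • volume := by
  have hlf := isLocallyFiniteMeasure_of_mass_ne_top hb.le (fun t => hbal t ▸ hl t) hl
  have hν := eq_withDensity_of_balance hb.le hl hbal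
  set f := rayleighConv b ν with hf
  have hfm : Measurable f := measurable_rayleighConv b ν
  have hft : ∀ᵐ x, f x ≠ ∞ := by
    rw [hν] at hlf
    exact ae_ne_top_of_isLocallyFiniteMeasure_withDensity hfm
  set g : ℝ → ℝ := fun x => (f x).toReal with hgdef
  have hgm : Measurable g := hfm.ennreal_toReal
  have hg0 (x : ℝ) : 0 ≤ g x := ENNReal.toReal_nonneg
  have hfg : f =ᵐ[volume] fun x => ENNReal.ofReal (g x) := by
    filter_upwards [hft] with x hx
    exact (ENNReal.ofReal_toReal hx).symm
  have hk0 (s x : ℝ) : 0 ≤ b * |x - s| * Real.exp (-b * (x - s) ^ 2) := by positivity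
  have hconv (s : ℝ) : f s =
      ∫⁻ x, ENNReal.ofReal (b * |x - s| * Real.exp (-b * (x - s) ^ 2) * g x) := by
    rw [hf, hν, withDensity_congr_ae hfg, rayleighConv_withDensity (by fun_prop)]
    refine lintegral_congr fun x => ?_
    rw [ENNReal.ofReal_mul (hk0 s x)]; rfl
  have hint (s : ℝ) (hs : f s ≠ ∞) :
      Integrable fun x => b * |x - s| * Real.exp (-b * (x - s) ^ 2) * g x := by
    refine (lintegral_ofReal_ne_top_iff_integrable (by fun_prop)
      (Eventually.of_forall fun x => mul_nonneg (hk0 s x) (hg0 x))).1 ?_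
    rwa [← hconv]
  -- This holds even where f s = ∞: both sides then take the default value 0.
  have hval (s : ℝ) : ∫ x, b * |x - s| * Real.exp (-b * (x - s) ^ 2) * g x = g s := by
    rw [integral_eq_lintegral_of_nonneg_ae
      (Eventually.of_forall fun x => mul_nonneg (hk0 s x) (hg0 x)) (by fun_prop), ← hconv]
  have hqm : Measurable fun x => Real.exp (-g x) := by fun_prop
  have hq1 (x : ℝ) : Real.exp (-g x) ≤ 1 := Real.exp_le_one_iff.2 (by linarith [hg0 x])
  have hqconv (s : ℝ) :
      rayleighConv b (volume.withDensity fun x => ENNReal.ofReal (Real.exp (-g x))) s =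
      ENNReal.ofReal (∫ x, b * |x - s| * Real.exp (-b * (x - s) ^ 2) * Real.exp (-g x)) := by
    rw [rayleighConv_withDensity (by fun_prop), ofReal_integral_eq_lintegral_ofReal]
    · refine lintegral_congr fun x => ?_
      rw [ENNReal.ofReal_mul (hk0 s x)]; rfl
    · refine ((integrable_rayleigh hb).comp_sub_right s).mono' (by fun_prop)
        (Eventually.of_forall fun x => ?_)
      rw [norm_mul, Real.norm_of_nonneg (hk0 s x), Real.norm_of_nonneg (Real.exp_pos _).le]
      exact mul_le_of_le_one_right (hk0 s x) (hq1 x)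
    · exact Eventually.of_forall fun x => mul_nonneg (hk0 s x) (Real.exp_pos _).le
  have hle : ∀ᵐ s, ENNReal.ofReal (Real.exp (-g s)) ≤
      rayleighConv b (volume.withDensity fun x => ENNReal.ofReal (Real.exp (-g x))) s := by
    filter_upwards [hft] with s hs
    rw [hqconv]
    exact ENNReal.ofReal_le_ofReal (exp_neg_jensen hb hgm hg0 (hint s hs) (hval s)).1
  have hqbal := balance_of_le_rayleighConv hb hqm (fun x => (Real.exp_pos _).le) hq1 hle
  have hqeq := eq_withDensity_of_balance hb.le (fun t => (hqbal t).2) (fun t => (hqbal t).1)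
  have hqae := (withDensity_eq_iff_of_sigmaFinite (by fun_prop)
    (measurable_rayleighConv b _).aemeasurable).1 hqeq
  -- A single point of equality in Jensen suffices, since κ charges the whole line.
  obtain ⟨s, hs1, hs2⟩ := (hqae.and hft).exists
  rw [hqconv, ENNReal.ofReal_eq_ofReal_iff (Real.exp_pos _).le
    (integral_nonneg fun x => mul_nonneg (hk0 s x) (Real.exp_pos _).le)] at hs1
  have hconst := (exp_neg_jensen hb hgm hg0 (hint s hs2) (hval s)).2 hs1
  refine ⟨ENNReal.ofReal (g s), ?_⟩
  rw [hν, ← withDensity_const]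
  refine withDensity_congr_ae ?_
  filter_upwards [hfg, hconst] with x h1 h2
  rw [h1, h2]

end GaussianBalance

/-! ### Medians of normalised finite measures. -/

open ProbabilityTheory

namespace NatExpFamily

section Median

lemma one_half_le_cdf_of_quantile_lt {μ : Measure ℝ} [IsProbabilityMeasure μ] {x : ℝ}
    (hx : quantile μ (1 / 2) < x) : 1 / 2 ≤ cdf μ x := by
  have hne : {x : ℝ | 1 / 2 ≤ cdf μ x}.Nonempty :=
    (((tendsto_cdf_atTop μ).eventually (lt_mem_nhds (by norm_num : (1 / 2 : ℝ) < 1))).exists).imp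
      fun _ h => le_of_lt h
  obtain ⟨z, hz, hzx⟩ := exists_lt_of_csInf_lt hne hx
  exact le_trans hz (monotone_cdf μ hzx.le)

lemma bddBelow_one_half_le_cdf (μ : Measure ℝ) [IsProbabilityMeasure μ] :
    BddBelow {x : ℝ | 1 / 2 ≤ cdf μ x} := by
  obtain ⟨N, hN⟩ :=
    ((tendsto_cdf_atBot μ).eventually (gt_mem_nhds (by norm_num : (0 : ℝ) < 1 / 2))).exists
  refine ⟨N, fun x hx => ?_⟩
  by_contra hlt
  exact absurd (le_trans hx (monotone_cdf μ (not_le.1 hlt).le)) (not_le.2 hN)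

lemma cdf_lt_one_half_of_lt_quantile {μ : Measure ℝ} [IsProbabilityMeasure μ] {x : ℝ}
    (hx : x < quantile μ (1 / 2)) : cdf μ x < 1 / 2 :=
  not_le.1 fun h => absurd (csInf_le (bddBelow_one_half_le_cdf μ) h) (not_le.2 hx)

lemma one_half_le_measureReal_Iic_quantile (μ : Measure ℝ) [IsProbabilityMeasure μ] :
    1 / 2 ≤ μ.real (Iic (quantile μ (1 / 2))) := by
  rw [← cdf_eq_real]
  have h := ((cdf μ).right_continuous (quantile μ (1 / 2))).mono_left
    (nhdsWithin_mono _ Ioi_subset_Ici_self)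
  exact ge_of_tendsto h (eventually_mem_nhdsWithin.mono fun x hx =>
    one_half_le_cdf_of_quantile_lt hx)

lemma measureReal_Iio_quantile_le (μ : Measure ℝ) [IsProbabilityMeasure μ] :
    μ.real (Iio (quantile μ (1 / 2))) ≤ 1 / 2 := by
  have h1 : μ (Iio (quantile μ (1 / 2))) =
      ENNReal.ofReal (Function.leftLim (cdf μ) (quantile μ (1 / 2)) - 0) := by
    rw [← StieltjesFunction.measure_Iio _ (tendsto_cdf_atBot μ), measure_cdf]
  have h2 : Function.leftLim (cdf μ) (quantile μ (1 / 2)) ≤ 1 / 2 :=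
    le_of_tendsto ((monotone_cdf μ).tendsto_leftLim _)
      (eventually_mem_nhdsWithin.mono fun x hx => (cdf_lt_one_half_of_lt_quantile hx).le)
  rw [measureReal_def, h1, sub_zero]
  exact ENNReal.toReal_le_of_le_ofReal (by norm_num) (ENNReal.ofReal_le_ofReal h2)

lemma measureReal_normalized (T : Measure ℝ) (s : Set ℝ) :
    ((T univ)⁻¹ • T).real s = (T.real univ)⁻¹ * T.real s := by
  simp [measureReal_def]

lemma measure_le_of_quantile_normalized {T : Measure ℝ} [IsFiniteMeasure T] [NeZero T] {m : ℝ}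
    (hm : quantile ((T univ)⁻¹ • T) (1 / 2) = m) :
    T (Ioi m) ≤ T (Iic m) ∧ T (Iio m) ≤ T (Ici m) := by
  have hT : 0 < T.real univ := measureReal_univ_pos
  have h1 := one_half_le_measureReal_Iic_quantile ((T univ)⁻¹ • T)
  have h2 := measureReal_Iio_quantile_le ((T univ)⁻¹ • T)
  rw [hm, measureReal_normalized] at h1 h2
  have e1 := measureReal_add_measureReal_compl (μ := T) (measurableSet_Iic (a := m))
  have e2 := measureReal_add_measureReal_compl (μ := T) (measurableSet_Iio (a := m))
  rw [compl_Iic] at e1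
  rw [compl_Iio] at e2
  rw [inv_mul_eq_div, le_div_iff₀ hT] at h1
  rw [inv_mul_eq_div, div_le_iff₀ hT] at h2
  constructor
  · exact (ENNReal.toReal_le_toReal (measure_ne_top _ _) (measure_ne_top _ _)).1
      (show T.real _ ≤ T.real _ by linarith)
  · exact (ENNReal.toReal_le_toReal (measure_ne_top _ _) (measure_ne_top _ _)).1
      (show T.real _ ≤ T.real _ by linarith)

/-- The strict inequality to the left of m makes m the least median, which is the one the infimum
selects. -/
lemma quantile_normalized_eq {T : Measure ℝ} [IsFiniteMeasure T] [NeZero T] {m : ℝ}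
    (h1 : T (Ioi m) ≤ T (Iic m)) (h2 : ∀ x < m, T (Iic x) < T (Ioi x)) :
    quantile ((T univ)⁻¹ • T) (1 / 2) = m := by
  have hT : 0 < T.real univ := measureReal_univ_pos
  have e (x : ℝ) := measureReal_add_measureReal_compl (μ := T) (measurableSet_Iic (a := x))
  simp only [compl_Iic] at e
  have hmem : m ∈ {x : ℝ | 1 / 2 ≤ cdf ((T univ)⁻¹ • T) x} := by
    have : T.real _ ≤ T.real _ := ENNReal.toReal_mono (measure_ne_top _ _) h1
    rw [mem_ofPred_eq, cdf_eq_real, measureReal_normalized, inv_mul_eq_div, le_div_iff₀ hT]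
    linarith [e m]
  refine le_antisymm (csInf_le (bddBelow_one_half_le_cdf _) hmem) (le_csInf ⟨m, hmem⟩ fun x hx => ?_)
  by_contra hlt
  have : T.real _ < T.real _ :=
    (ENNReal.toReal_lt_toReal (measure_ne_top _ _) (measure_ne_top _ _)).2 (h2 x (not_le.1 hlt))
  rw [mem_ofPred_eq, cdf_eq_real, measureReal_normalized, inv_mul_eq_div, le_div_iff₀ hT] at hx
  linarith [e x]

end Median

/-! ### Tilted measures and reduction of both conditions to a balance. -/

section Tilt

/-- The measure `exp (x y - ψ(x)) P(dx)`, proportional to the conditional law of `X` given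
`Y = y`. -/
noncomputable def tilt (ψ : ℝ → ℝ) (P : Measure ℝ) (y : ℝ) : Measure ℝ :=
  P.withDensity fun x => ENNReal.ofReal (Real.exp (x * y - ψ x))

variable {h ψ : ℝ → ℝ} {P : Measure ℝ}

/-- Normalisation forces ψ to be the logarithm of the Laplace transform of h, a parametric integral.
-/
lemma IsNaturalExponentialFamily.measurable_logPartition (hfam : IsNaturalExponentialFamily h ψ) :
    Measurable ψ := by
  have hm := hfam.measurable_base
  have key (x : ℝ) : ψ x = Real.log (∫⁻ y, ENNReal.ofReal (h y * Real.exp (x * y))).toReal := by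
    have h1 := hfam.lintegral_eq_one x
    have h2 (y : ℝ) : ENNReal.ofReal (condDensity h ψ x y) =
        ENNReal.ofReal (h y * Real.exp (x * y)) * ENNReal.ofReal (Real.exp (-ψ x)) := by
      rw [← ENNReal.ofReal_mul (mul_nonneg (hfam.base_nonneg y) (Real.exp_pos _).le), mul_assoc,
        ← Real.exp_add]
      rfl
    simp only [h2] at h1
    rw [lintegral_mul_const _ (by fun_prop)] at h1
    have h3 := congrArg ENNReal.toReal h1
    rw [ENNReal.toReal_mul, ENNReal.toReal_ofReal (Real.exp_pos _).le, ENNReal.toReal_one,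
      Real.exp_neg] at h3
    have h4 := eq_of_div_eq_one ((div_eq_mul_inv _ _).trans h3)
    rw [h4, Real.log_exp]
  rw [funext key]
  refine Real.measurable_log.comp (Measurable.ennreal_toReal ?_)
  exact Measurable.lintegral_prod_right' (f := fun p : ℝ × ℝ =>
    ENNReal.ofReal (h p.2 * Real.exp (p.1 * p.2))) (by fun_prop)

/-- From -ψ(x) ≤ C - x²/2 and xy - x²/2 ≤ y²/2. The bound is uniform in x, so every tilt is finite
and dominated convergence in y is available. -/
lemma exists_exponent_le (hψ : BddAbove (range fun x : ℝ => x ^ 2 / 2 - ψ x)) :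
    ∃ C, ∀ x y : ℝ, x * y - ψ x ≤ C + y ^ 2 / 2 := by
  obtain ⟨C, hC⟩ := hψ
  refine ⟨C, fun x y => ?_⟩
  have := hC (mem_range_self x)
  nlinarith [sq_nonneg (x - y)]

lemma isFiniteMeasure_tilt [IsFiniteMeasure P]
    (hψ : BddAbove (range fun x : ℝ => x ^ 2 / 2 - ψ x)) (y : ℝ) :
    IsFiniteMeasure (tilt ψ P y) := by
  obtain ⟨C, hC⟩ := exists_exponent_le hψ
  refine isFiniteMeasure_withDensity (ne_of_lt ?_)
  calc _ ≤ ∫⁻ _, ENNReal.ofReal (Real.exp (C + y ^ 2 / 2)) ∂P :=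
        lintegral_mono fun x => ENNReal.ofReal_le_ofReal (Real.exp_le_exp.2 (hC x y))
    _ < ∞ := by
        rw [lintegral_const]
        exact ENNReal.mul_lt_top ENNReal.ofReal_lt_top (measure_lt_top _ _)

lemma absolutelyContinuous_tilt (hm : Measurable ψ) (y : ℝ) : P ≪ tilt ψ P y :=
  withDensity_absolutelyContinuous' (by fun_prop)
    (Eventually.of_forall fun x => by simpa using Real.exp_pos _)

lemma neZero_tilt [IsProbabilityMeasure P] (hm : Measurable ψ) (y : ℝ) :
    NeZero (tilt ψ P y) := by
  refine ⟨fun h0 => ?_⟩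
  have := absolutelyContinuous_tilt (P := P) hm y (s := univ) (by simp [h0])
  simp at this

lemma marginalDensity_eq (hfam : IsNaturalExponentialFamily h ψ) (y : ℝ) :
    marginalDensity h ψ P y = ENNReal.ofReal (h y) * tilt ψ P y univ := by
  have := hfam.measurable_logPartition
  rw [tilt, withDensity_apply _ MeasurableSet.univ, Measure.restrict_univ,
    ← lintegral_const_mul _ (by fun_prop)]
  exact lintegral_congr fun x => ENNReal.ofReal_mul (hfam.base_nonneg y)

lemma posteriorLaw_eq (hfam : IsNaturalExponentialFamily h ψ) {y : ℝ} (hy : 0 < h y) :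
    posteriorLaw h ψ P y = (tilt ψ P y univ)⁻¹ • tilt ψ P y := by
  have := hfam.measurable_logPartition
  conv_rhs => rw [tilt]
  rw [← withDensity_smul _ (by fun_prop), posteriorLaw]
  congr 1
  ext x
  rw [marginalDensity_eq hfam, condDensity, ENNReal.ofReal_mul (hfam.base_nonneg y),
    ENNReal.mul_div_mul_left _ _ (by simpa using hy) ENNReal.ofReal_ne_top, Pi.smul_apply,
    smul_eq_mul, div_eq_mul_inv, mul_comm]
  rfl

/-- The factor h(y) cancels in Bayes' formula, and the tilt is never zero, so f_Y(y) ≠ 0 exactly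
when h(y) > 0. -/
lemma hasLinearMedian_iff [IsProbabilityMeasure P] (hfam : IsNaturalExponentialFamily h ψ) (a : ℝ) :
    HasLinearMedian h ψ P a ↔ ∀ y, 0 < h y →
      quantile ((tilt ψ P y univ)⁻¹ • tilt ψ P y) (1 / 2) = a * y := by
  refine forall_congr' fun y => ?_
  have := neZero_tilt (P := P) hfam.measurable_logPartition y
  have hne : marginalDensity h ψ P y ≠ 0 ↔ 0 < h y := by
    rw [marginalDensity_eq hfam, mul_ne_zero_iff]
    simp [NeZero.ne]
  rw [hne]
  refine forall_congr' fun hy => ?_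
  rw [condMedian, posteriorLaw_eq hfam hy]

lemma integral_sign_sub (T : Measure ℝ) [IsFiniteMeasure T] (m : ℝ) :
    ∫ x, Real.sign (x - m) ∂T = T.real (Ioi m) - T.real (Iio m) := by
  have : (fun x => Real.sign (x - m)) = fun x =>
      (Ioi m).indicator (1 : ℝ → ℝ) x - (Iio m).indicator 1 x := by
    ext x
    rcases lt_trichotomy x m with hx | hx | hx
    · simp [hx, hx.le, Real.sign_of_neg (sub_neg.2 hx)]
    · simp [hx]
    · simp [hx, hx.le, Real.sign_of_pos (sub_pos.2 hx)]
  rw [this, integral_sub ((integrable_const 1).indicator measurableSet_Ioi)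
    ((integrable_const 1).indicator measurableSet_Iio), integral_indicator_one measurableSet_Ioi,
    integral_indicator_one measurableSet_Iio]

lemma measurable_sign_sub (m : ℝ) : Measurable fun x : ℝ => Real.sign (x - m) := by
  unfold Real.sign
  refine Measurable.ite (measurableSet_lt (by fun_prop) (by fun_prop)) (by fun_prop) ?_
  exact Measurable.ite (measurableSet_lt (by fun_prop) (by fun_prop)) (by fun_prop) (by fun_prop)

lemma signCondition_iff [IsProbabilityMeasure P] (hfam : IsNaturalExponentialFamily h ψ)
    (hψ : BddAbove (range fun x : ℝ => x ^ 2 / 2 - ψ x)) (a : ℝ) :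
    SignCondition h ψ P a ↔ ∀ y, 0 < h y →
      tilt ψ P y (Ioi (a * y)) = tilt ψ P y (Iio (a * y)) := by
  refine forall_congr' fun y => ?_
  have hm := hfam.measurable_logPartition
  have := isFiniteMeasure_tilt (P := P) hψ y
  have hint : Integrable
      (fun x => Real.sign (x - a * y) * (h y * Real.exp (x * y - ψ x))) P := by
    obtain ⟨C, hC⟩ := exists_exponent_le hψ
    refine (integrable_const (h y * Real.exp (C + y ^ 2 / 2))).mono'
      (((measurable_sign_sub _).mul (by fun_prop)).aestronglyMeasurable)
      (Eventually.of_forall fun x => ?_)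
    have h1 : ‖Real.sign (x - a * y)‖ ≤ 1 := by
      rcases Real.sign_apply_eq (x - a * y) with h | h | h <;> simp [h]
    have h2 : 0 ≤ h y := hfam.base_nonneg y
    rw [norm_mul, norm_mul, Real.norm_of_nonneg h2, Real.norm_of_nonneg (Real.exp_pos _).le]
    calc _ ≤ 1 * (h y * Real.exp (C + y ^ 2 / 2)) := by
          gcongr
          exact hC x y
      _ = _ := one_mul _
  have hval : ∫ x, Real.sign (x - a * y) * (h y * Real.exp (x * y - ψ x)) ∂P =
      h y * ((tilt ψ P y).real (Ioi (a * y)) - (tilt ψ P y).real (Iio (a * y))) := by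
    rw [← integral_sign_sub, tilt, integral_withDensity_eq_integral_toReal_smul (by fun_prop)
      (Eventually.of_forall fun _ => ENNReal.ofReal_lt_top), ← integral_const_mul]
    refine integral_congr_ae (Eventually.of_forall fun x => ?_)
    simp only [smul_eq_mul]
    rw [ENNReal.toReal_ofReal (Real.exp_pos _).le]
    ring
  rw [hval, mul_eq_zero, sub_eq_zero, measureReal_def, measureReal_def,
    ENNReal.toReal_eq_toReal_iff' (measure_ne_top _ _) (measure_ne_top _ _)]
  constructor
  · rintro ⟨-, h0 | h0⟩ hy
    · exact absurd h0 hy.ne'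
    · exact h0
  · intro H
    refine ⟨hint, ?_⟩
    rcases (hfam.base_nonneg y).eq_or_lt with h0 | h0
    · exact Or.inl h0.symm
    · exact Or.inr (H h0)

/-- `a y` is a median of the conditional law of `X` given `Y = y`, for every `y` in the support of
the base density. -/
def MedianBalanced (h ψ : ℝ → ℝ) (P : Measure ℝ) (a : ℝ) : Prop :=
  ∀ y, 0 < h y → tilt ψ P y (Ioi (a * y)) ≤ tilt ψ P y (Iic (a * y)) ∧
    tilt ψ P y (Iio (a * y)) ≤ tilt ψ P y (Ici (a * y))

lemma SignCondition.medianBalanced [IsProbabilityMeasure P]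
    (hfam : IsNaturalExponentialFamily h ψ)
    (hψ : BddAbove (range fun x : ℝ => x ^ 2 / 2 - ψ x)) {a : ℝ} (H : SignCondition h ψ P a) :
    MedianBalanced h ψ P a := fun y hy => by
  have h1 := (signCondition_iff hfam hψ a).1 H y hy
  exact ⟨h1.le.trans (measure_mono Iio_subset_Iic_self),
    h1.ge.trans (measure_mono Ioi_subset_Ici_self)⟩

lemma HasLinearMedian.medianBalanced [IsProbabilityMeasure P]
    (hfam : IsNaturalExponentialFamily h ψ)
    (hψ : BddAbove (range fun x : ℝ => x ^ 2 / 2 - ψ x)) {a : ℝ} (H : HasLinearMedian h ψ P a) :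
    MedianBalanced h ψ P a := fun y hy => by
  have := isFiniteMeasure_tilt (P := P) hψ y
  have := neZero_tilt (P := P) hfam.measurable_logPartition y
  exact measure_le_of_quantile_normalized ((hasLinearMedian_iff hfam a).1 H y hy)

lemma tendsto_tilt [IsProbabilityMeasure P] (hm : Measurable ψ)
    (hψ : BddAbove (range fun x : ℝ => x ^ 2 / 2 - ψ x)) {y : ℝ} {D : Set ℝ}
    {S : ℝ → Set ℝ} {S₀ : Set ℝ} (hS : ∀ y, MeasurableSet (S y)) (hS₀ : MeasurableSet S₀)
    (hlim : ∀ x, ∀ᶠ y' in 𝓝[D] y, (x ∈ S y' ↔ x ∈ S₀)) :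
    Tendsto (fun y' => tilt ψ P y' (S y')) (𝓝[D] y) (𝓝 (tilt ψ P y S₀)) := by
  obtain ⟨C, hC⟩ := exists_exponent_le hψ
  simp only [tilt, withDensity_apply _ (hS _), withDensity_apply _ hS₀,
    ← lintegral_indicator (hS _), ← lintegral_indicator hS₀]
  refine tendsto_lintegral_filter_of_dominated_convergence
    (fun _ => ENNReal.ofReal (Real.exp (C + (|y| + 1) ^ 2 / 2))) ?_ ?_ ?_ ?_
  · exact Eventually.of_forall fun y' => Measurable.indicator (by fun_prop) (hS y')
  · have hn : ∀ᶠ y' in 𝓝[D] y, |y'| < |y| + 1 :=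
      nhdsWithin_le_nhds (continuous_abs.continuousAt.eventually (gt_mem_nhds (by linarith)))
    filter_upwards [hn] with y' hy'
    refine Eventually.of_forall fun x => (indicator_le_self _ _ _).trans ?_
    refine ENNReal.ofReal_le_ofReal (Real.exp_le_exp.2 ((hC x y').trans ?_))
    have : y' ^ 2 ≤ (|y| + 1) ^ 2 := sq_le_sq' (by linarith [(abs_lt.1 hy').1])
      (abs_lt.1 hy').2.le
    linarith
  · rw [lintegral_const]
    exact (ENNReal.mul_lt_top ENNReal.ofReal_lt_top (measure_lt_top _ _)).ne
  · refine Eventually.of_forall fun x => ?_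
    have hc : Tendsto (fun y' => S₀.indicator
        (fun x => ENNReal.ofReal (Real.exp (x * y' - ψ x))) x) (𝓝[D] y)
        (𝓝 (S₀.indicator (fun x => ENNReal.ofReal (Real.exp (x * y - ψ x))) x)) := by
      by_cases hx : x ∈ S₀
      · simp only [indicator_of_mem hx]
        have : Continuous fun y' => ENNReal.ofReal (Real.exp (x * y' - ψ x)) :=
          ENNReal.continuous_ofReal.comp (by fun_prop)
        exact this.continuousWithinAt
      · simp only [indicator_of_notMem hx]
        exact tendsto_const_nhds
    refine hc.congr' ?_
    filter_upwards [hlim x] with y' hy'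
    by_cases hx : x ∈ S₀
    · rw [indicator_of_mem hx, indicator_of_mem (hy'.2 hx)]
    · rw [indicator_of_notMem hx, indicator_of_notMem (fun h => hx (hy'.1 h))]

/-- Approach y from the right within {h > 0}. Both Iio and Iic at ay' then converge to Iic at ay,
and both Ioi and Ici to Ioi, so the two weak median inequalities become opposite inequalities
between the same masses, at every y and despite possible atoms. -/
lemma MedianBalanced.tilt_eq [IsProbabilityMeasure P] (hm : Measurable ψ)
    (hpos : Dense {y : ℝ | 0 < h y})
    (hψ : BddAbove (range fun x : ℝ => x ^ 2 / 2 - ψ x)) {a : ℝ} (ha : 0 < a)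
    (H : MedianBalanced h ψ P a) (y : ℝ) :
    tilt ψ P y (Ioi (a * y)) = tilt ψ P y (Iic (a * y)) := by
  set D := Ioi y ∩ {y : ℝ | 0 < h y} with hD
  have hne : (𝓝[D] y).NeBot := by
    rw [← mem_closure_iff_nhdsWithin_neBot]
    have h1 : closure (Ioi y) ⊆ closure D :=
      closure_minimal (hpos.open_subset_closure_inter isOpen_Ioi) isClosed_closure
    exact h1 (by simp)
  have hD1 : ∀ᶠ y' in 𝓝[D] y, a * y < a * y' :=
    eventually_mem_nhdsWithin.mono fun y' hy' => mul_lt_mul_of_pos_left hy'.1 ha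
  have hD2 : ∀ᶠ y' in 𝓝[D] y, 0 < h y' := eventually_mem_nhdsWithin.mono fun y' hy' => hy'.2
  have hD3 (x : ℝ) (hx : a * y < x) : ∀ᶠ y' in 𝓝[D] y, a * y' < x :=
    nhdsWithin_le_nhds ((continuous_const_mul a).continuousAt.eventually (gt_mem_nhds hx))
  have hdich (x : ℝ) : ∀ᶠ y' in 𝓝[D] y, (x ≤ a * y ∧ x < a * y') ∨ (a * y < x ∧ a * y' < x) := by
    rcases le_or_gt x (a * y) with hx | hx
    · exact hD1.mono fun y' hy' => Or.inl ⟨hx, hx.trans_lt hy'⟩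
    · exact (hD3 x hx).mono fun y' hy' => Or.inr ⟨hx, hy'⟩
  have t1 := tendsto_tilt (P := P) (y := y) (D := D) (S := fun y => Ioi (a * y))
    (S₀ := Ioi (a * y)) hm hψ (fun _ => measurableSet_Ioi) measurableSet_Ioi
    (fun x => (hdich x).mono fun y' hy' => by simp only [mem_Ioi]; grind)
  have t2 := tendsto_tilt (P := P) (y := y) (D := D) (S := fun y => Iic (a * y))
    (S₀ := Iic (a * y)) hm hψ (fun _ => measurableSet_Iic) measurableSet_Iic
    (fun x => (hdich x).mono fun y' hy' => by simp only [mem_Iic]; grind)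
  have t3 := tendsto_tilt (P := P) (y := y) (D := D) (S := fun y => Iio (a * y))
    (S₀ := Iic (a * y)) hm hψ (fun _ => measurableSet_Iio) measurableSet_Iic
    (fun x => (hdich x).mono fun y' hy' => by simp only [mem_Iic, mem_Iio]; grind)
  have t4 := tendsto_tilt (P := P) (y := y) (D := D) (S := fun y => Ici (a * y))
    (S₀ := Ioi (a * y)) hm hψ (fun _ => measurableSet_Ici) measurableSet_Ioi
    (fun x => (hdich x).mono fun y' hy' => by simp only [mem_Ioi, mem_Ici]; grind)
  exact le_antisymm (le_of_tendsto_of_tendsto t1 t2 (hD2.mono fun y' hy' => (H y' hy').1))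
    (le_of_tendsto_of_tendsto t3 t4 (hD2.mono fun y' hy' => (H y' hy').2))

end Tilt

end NatExpFamily

namespace NatExpFamily

/-! ### Positive slope: identification of the prior. -/

section PositiveSlope

open GaussianBalance

variable {h ψ : ℝ → ℝ} {P : Measure ℝ}

lemma setLIntegral_gaussKernel_withDensity (hm : Measurable ψ) {a : ℝ} (ha : 0 < a) (y : ℝ)
    {S : Set ℝ} (hS : MeasurableSet S) :
    ∫⁻ x in S, gaussKernel (1 / (2 * a)) (x - a * y)
        ∂(P.withDensity fun x => ENNReal.ofReal (Real.exp (x ^ 2 / (2 * a) - ψ x))) =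
      ENNReal.ofReal (Real.exp (-(a * y ^ 2 / 2))) * tilt ψ P y S := by
  rw [tilt, withDensity_apply _ hS, restrict_withDensity hS,
    lintegral_withDensity_eq_lintegral_mul _ (by fun_prop) (by fun_prop),
    ← lintegral_const_mul _ (by fun_prop)]
  refine lintegral_congr fun x => ?_
  rw [Pi.mul_apply, gaussKernel, ← ENNReal.ofReal_mul (Real.exp_pos _).le,
    ← ENNReal.ofReal_mul (Real.exp_pos _).le, ← Real.exp_add, ← Real.exp_add]
  congr 2
  field_simp
  ring

lemma measurable_priorWeight (hm : Measurable ψ) (a : ℝ) : Measurable (priorWeight ψ a) := by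
  unfold priorWeight
  fun_prop

lemma lintegral_priorWeight_ne_zero (hm : Measurable ψ) (a : ℝ) :
    ∫⁻ x, ENNReal.ofReal (priorWeight ψ a x) ≠ 0 := by
  have := measurable_priorWeight hm a
  rw [Ne, lintegral_eq_zero_iff (by fun_prop)]
  intro h0
  obtain ⟨x, hx⟩ := h0.exists
  exact absurd hx (by simpa [priorWeight] using Real.exp_pos _)

lemma matchingPrior_eq_smul (hm : Measurable ψ) {a : ℝ} (hint : Integrable (priorWeight ψ a)) :
    matchingPrior ψ a = (∫⁻ x, ENNReal.ofReal (priorWeight ψ a x))⁻¹ •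
      volume.withDensity fun x => ENNReal.ofReal (priorWeight ψ a x) := by
  have := measurable_priorWeight hm a
  have hZ : ∫⁻ x, ENNReal.ofReal (priorWeight ψ a x) =
      ENNReal.ofReal (∫ t, priorWeight ψ a t) :=
    (ofReal_integral_eq_lintegral_ofReal hint
      (Eventually.of_forall fun x => (Real.exp_pos _).le)).symm
  have h0 : 0 < ∫ t, priorWeight ψ a t := by
    have := lintegral_priorWeight_ne_zero hm a
    rwa [hZ, Ne, ENNReal.ofReal_eq_zero, not_le] at this
  rw [← withDensity_smul _ (by fun_prop), matchingPrior, hZ]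
  congr 1
  ext x
  rw [Pi.smul_apply, smul_eq_mul, ENNReal.ofReal_div_of_pos h0, div_eq_mul_inv, mul_comm]

lemma isProbabilityMeasure_matchingPrior (hm : Measurable ψ) {a : ℝ}
    (hint : Integrable (priorWeight ψ a)) : IsProbabilityMeasure (matchingPrior ψ a) := by
  refine ⟨?_⟩
  rw [matchingPrior_eq_smul hm hint, Measure.smul_apply, withDensity_apply _ MeasurableSet.univ,
    Measure.restrict_univ, smul_eq_mul]
  exact ENNReal.inv_mul_cancel (lintegral_priorWeight_ne_zero hm a)
    ((lintegral_ofReal_ne_top_iff_integrable (measurable_priorWeight hm a).aestronglyMeasurable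
      (Eventually.of_forall fun x => (Real.exp_pos _).le)).2 hint)

lemma MedianBalanced.eq_matchingPrior [IsProbabilityMeasure P] (hm : Measurable ψ)
    (hpos : Dense {y : ℝ | 0 < h y})
    (hψ : BddAbove (range fun x : ℝ => x ^ 2 / 2 - ψ x)) {a : ℝ} (ha : 0 < a)
    (H : MedianBalanced h ψ P a) :
    Integrable (priorWeight ψ a) ∧ P = matchingPrior ψ a := by
  set ν := P.withDensity fun x => ENNReal.ofReal (Real.exp (x ^ 2 / (2 * a) - ψ x)) with hν
  have hwm := measurable_priorWeight hm a
  have hfin (y : ℝ) := isFiniteMeasure_tilt (P := P) hψ y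
  have hl (t : ℝ) : lowerMass (1 / (2 * a)) ν t ≠ ∞ := by
    have h1 := setLIntegral_gaussKernel_withDensity (P := P) hm ha (t / a)
      (measurableSet_Iic (a := t))
    rw [mul_div_cancel₀ t ha.ne'] at h1
    rw [lowerMass, h1]
    exact ENNReal.mul_ne_top ENNReal.ofReal_ne_top (measure_ne_top _ _)
  have hbal (t : ℝ) : upperMass (1 / (2 * a)) ν t = lowerMass (1 / (2 * a)) ν t := by
    have h1 := setLIntegral_gaussKernel_withDensity (P := P) hm ha (t / a)
      (measurableSet_Iic (a := t))
    have h2 := setLIntegral_gaussKernel_withDensity (P := P) hm ha (t / a)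
      (measurableSet_Ioi (a := t))
    have h3 := H.tilt_eq hm hpos hψ ha (t / a)
    rw [mul_div_cancel₀ t ha.ne'] at h1 h2 h3
    rw [lowerMass, h1, upperMass, h2, h3]
  obtain ⟨c, hc⟩ := eq_smul_volume_of_balance (by positivity) hl hbal
  have hP : P = c • volume.withDensity fun x => ENNReal.ofReal (priorWeight ψ a x) := by
    rw [← withDensity_smul_measure, ← hc, hν, ← withDensity_mul _ (by fun_prop) (by fun_prop)]
    conv_lhs => rw [← withDensity_one (μ := P)]
    congr 1
    ext x
    rw [Pi.mul_apply, priorWeight, ← ENNReal.ofReal_mul (Real.exp_pos _).le, ← Real.exp_add]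
    have : x ^ 2 / (2 * a) - ψ x + (-x ^ 2 / (2 * a) + ψ x) = 0 := by ring
    simp [this]
  have h1 : c * ∫⁻ x, ENNReal.ofReal (priorWeight ψ a x) = 1 := by
    have h2 : P univ = 1 := measure_univ
    rwa [hP, Measure.smul_apply, withDensity_apply _ MeasurableSet.univ, Measure.restrict_univ,
      smul_eq_mul] at h2
  -- Integrability is a consequence of P having total mass one.
  have htop : ∫⁻ x, ENNReal.ofReal (priorWeight ψ a x) ≠ ∞ := by
    intro ht
    have hc0 : c ≠ 0 := by
      rintro rfl
      simp at h1
    rw [ht, ENNReal.mul_top hc0] at h1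
    exact ENNReal.top_ne_one h1
  have hint := (lintegral_ofReal_ne_top_iff_integrable hwm.aestronglyMeasurable
      (Eventually.of_forall fun x => (Real.exp_pos _).le)).1 htop
  refine ⟨hint, ?_⟩
  rw [matchingPrior_eq_smul hm hint, ← ENNReal.eq_inv_of_mul_eq_one_left h1]
  exact hP

/-- The factors exp(±ψ) cancel, leaving a multiple of the Gaussian law with mean ay and variance a.
-/
lemma tilt_matchingPrior (hm : Measurable ψ) {a : ℝ} (ha : 0 < a)
    (hint : Integrable (priorWeight ψ a)) (y : ℝ) :
    tilt ψ (matchingPrior ψ a) y = (∫⁻ x, ENNReal.ofReal (priorWeight ψ a x))⁻¹ •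
      volume.withDensity fun x =>
        ENNReal.ofReal (Real.exp (-(x - a * y) ^ 2 / (2 * a) + a * y ^ 2 / 2)) := by
  have := measurable_priorWeight hm a
  rw [tilt, matchingPrior_eq_smul hm hint, withDensity_smul_measure,
    ← withDensity_mul _ (by fun_prop) (by fun_prop)]
  congr 2
  ext x
  rw [Pi.mul_apply, priorWeight, ← ENNReal.ofReal_mul (Real.exp_pos _).le, ← Real.exp_add]
  congr 2
  field_simp
  ring

lemma tilt_matchingPrior_symm (hm : Measurable ψ) {a : ℝ} (ha : 0 < a)
    (hint : Integrable (priorWeight ψ a)) (y : ℝ) :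
    tilt ψ (matchingPrior ψ a) y (Ioi (a * y)) = tilt ψ (matchingPrior ψ a) y (Iio (a * y)) := by
  rw [tilt_matchingPrior hm ha hint, Measure.smul_apply, Measure.smul_apply,
    withDensity_apply _ measurableSet_Ioi, withDensity_apply _ measurableSet_Iio,
    ← lintegral_indicator measurableSet_Ioi, ← lintegral_indicator measurableSet_Iio]
  congr 1
  -- Reflection about the centre ay.
  rw [← lintegral_sub_left_eq_self _ (2 * (a * y))]
  refine lintegral_congr fun x => ?_
  by_cases hx : x < a * y
  · have h1 : 2 * (a * y) - x ∈ Ioi (a * y) := by simp only [mem_Ioi]; linarith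
    rw [indicator_of_mem h1, indicator_of_mem (show x ∈ Iio (a * y) from hx)]
    ring_nf
  · have h1 : 2 * (a * y) - x ∉ Ioi (a * y) := by simp only [mem_Ioi]; linarith
    rw [indicator_of_notMem h1, indicator_of_notMem (show x ∉ Iio (a * y) from hx)]

lemma tilt_matchingPrior_noAtom (hm : Measurable ψ) {a : ℝ} (ha : 0 < a)
    (hint : Integrable (priorWeight ψ a)) (y m : ℝ) :
    tilt ψ (matchingPrior ψ a) y (Iio m) = tilt ψ (matchingPrior ψ a) y (Iic m) := by
  rw [tilt_matchingPrior hm ha hint, Measure.smul_apply, Measure.smul_apply,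
    measure_congr Iio_ae_eq_Iic]

/-- Supplies the strictness that makes ay the least median. -/
lemma tilt_matchingPrior_pos (hm : Measurable ψ) {a : ℝ}
    (hint : Integrable (priorWeight ψ a)) (y : ℝ) {c d : ℝ} (hcd : c < d) :
    0 < tilt ψ (matchingPrior ψ a) y (Ioc c d) := by
  have hprob := isProbabilityMeasure_matchingPrior hm hint
  have hwm := measurable_priorWeight hm a
  refine pos_iff_ne_zero.2 fun h0 => ?_
  have h1 := absolutelyContinuous_tilt (P := matchingPrior ψ a) hm y h0
  rw [matchingPrior_eq_smul hm hint, Measure.smul_apply, smul_eq_mul, mul_eq_zero,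
    ENNReal.inv_eq_zero] at h1
  rcases h1 with h1 | h1
  · exact (lintegral_ofReal_ne_top_iff_integrable hwm.aestronglyMeasurable
      (Eventually.of_forall fun x => (Real.exp_pos _).le)).2 hint h1
  · have h2 := withDensity_absolutelyContinuous' (μ := volume)
      (f := fun x => ENNReal.ofReal (priorWeight ψ a x)) (by fun_prop)
      (Eventually.of_forall fun x => by simpa [priorWeight] using Real.exp_pos _) h1
    rw [Real.volume_Ioc, ENNReal.ofReal_eq_zero] at h2
    linarith

lemma hasLinearMedian_matchingPrior (hfam : IsNaturalExponentialFamily h ψ)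
    (hψ : BddAbove (range fun x : ℝ => x ^ 2 / 2 - ψ x)) {a : ℝ} (ha : 0 < a)
    (hint : Integrable (priorWeight ψ a)) : HasLinearMedian h ψ (matchingPrior ψ a) a := by
  have hm := hfam.measurable_logPartition
  have hprob := isProbabilityMeasure_matchingPrior hm hint
  refine (hasLinearMedian_iff hfam a).2 fun y _ => ?_
  have := isFiniteMeasure_tilt (P := matchingPrior ψ a) hψ y
  have := neZero_tilt (P := matchingPrior ψ a) hm y
  have hsymm := (tilt_matchingPrior_symm hm ha hint y).trans
    (tilt_matchingPrior_noAtom hm ha hint y _)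
  refine quantile_normalized_eq hsymm.le fun x hx => ?_
  calc tilt ψ (matchingPrior ψ a) y (Iic x)
      < tilt ψ (matchingPrior ψ a) y (Iic x) + tilt ψ (matchingPrior ψ a) y (Ioc x (a * y)) :=
        ENNReal.lt_add_right (measure_ne_top _ _) (tilt_matchingPrior_pos hm hint y hx).ne'
    _ = tilt ψ (matchingPrior ψ a) y (Iic (a * y)) := by
        rw [← measure_union (Iic_disjoint_Ioc le_rfl) measurableSet_Ioc, Iic_union_Ioc_eq_Iic hx.le]
    _ = tilt ψ (matchingPrior ψ a) y (Ioi (a * y)) := hsymm.symm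
    _ ≤ _ := measure_mono (Ioi_subset_Ioi hx.le)

end PositiveSlope

/-! ### Zero slope: the unit mass at 0. -/

section ZeroSlope

variable {h ψ : ℝ → ℝ} {P : Measure ℝ}

/-- As sy → ∞, the tilted mass of {sx ≤ 0} stays below the total mass at y = 0, while that of {sx >
r} is multiplied by at least exp(r s y). The sign s = ±1 treats both half-lines at once. -/
lemma measure_halfLine_eq_zero [IsProbabilityMeasure P] (hm : Measurable ψ)
    (hψ : BddAbove (range fun x : ℝ => x ^ 2 / 2 - ψ x)) {s : ℝ} (hs : s * s = 1)
    (H : ∀ N : ℝ, ∃ y, N ≤ s * y ∧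
      tilt ψ P y {x | 0 < s * x} ≤ tilt ψ P y {x | s * x ≤ 0}) :
    P {x | 0 < s * x} = 0 := by
  have := isFiniteMeasure_tilt (P := P) hψ 0
  have hxy (x y : ℝ) : x * y = (s * x) * (s * y) := by
    linear_combination (-(x * y)) * hs
  have hmeas (r : ℝ) : MeasurableSet {x | r < s * x} := measurableSet_lt (by fun_prop) (by fun_prop)
  have hle (y : ℝ) (hy : 0 ≤ s * y) : tilt ψ P y {x | s * x ≤ 0} ≤ tilt ψ P 0 univ := by
    have hms : MeasurableSet {x | s * x ≤ 0} := measurableSet_le (by fun_prop) (by fun_prop)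
    refine le_trans ?_ (measure_mono (subset_univ {x | s * x ≤ 0}))
    rw [tilt, tilt, withDensity_apply _ hms, withDensity_apply _ hms]
    refine setLIntegral_mono (by fun_prop) fun x hx => ?_
    refine ENNReal.ofReal_le_ofReal (Real.exp_le_exp.2 ?_)
    have : (s * x) * (s * y) ≤ 0 := mul_nonpos_of_nonpos_of_nonneg hx hy
    rw [hxy x y]
    linarith
  have hge (r y : ℝ) (hy : 0 ≤ s * y) :
      ENNReal.ofReal (Real.exp (r * (s * y))) * tilt ψ P 0 {x | r < s * x} ≤
        tilt ψ P y {x | r < s * x} := by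
    rw [tilt, tilt, withDensity_apply _ (hmeas r), withDensity_apply _ (hmeas r),
      ← lintegral_const_mul _ (by fun_prop)]
    refine setLIntegral_mono (by fun_prop) fun x hx => ?_
    rw [← ENNReal.ofReal_mul (Real.exp_pos _).le, ← Real.exp_add]
    refine ENNReal.ofReal_le_ofReal (Real.exp_le_exp.2 ?_)
    have : r * (s * y) ≤ (s * x) * (s * y) := mul_le_mul_of_nonneg_right (le_of_lt hx) hy
    rw [hxy x y]
    linarith
  have hzero (r : ℝ) (hr : 0 < r) : tilt ψ P 0 {x | r < s * x} = 0 := by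
    by_contra hne
    set u := (tilt ψ P 0).real {x | r < s * x} with hu
    have hu0 : 0 < u := ENNReal.toReal_pos hne (measure_ne_top _ _)
    set M := (tilt ψ P 0).real univ with hM
    have hM0 : 0 ≤ M := measureReal_nonneg
    -- Chosen so that exp(r s y) > r s y ≥ M/u + 1, contradicting exp(r s y) u ≤ M.
    obtain ⟨y, hy, hy'⟩ := H ((M / u + 1) / r)
    have hsy : 0 ≤ s * y := le_trans (by positivity) hy
    have h1 := (hge r y hsy).trans ((measure_mono fun x (hx : r < s * x) => hr.trans hx).trans
      (hy'.trans (hle y hsy)))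
    have h2 := ENNReal.toReal_mono (measure_ne_top _ _) h1
    rw [ENNReal.toReal_mul, ENNReal.toReal_ofReal (Real.exp_pos _).le] at h2
    change _ * u ≤ M at h2
    have h3 : M / u + 1 ≤ r * (s * y) := by rwa [div_le_iff₀' hr] at hy
    have h4 := Real.add_one_le_exp (r * (s * y))
    rw [← le_div_iff₀ hu0] at h2
    linarith
  have hun : {x | 0 < s * x} = ⋃ n : ℕ, {x | 1 / ((n : ℝ) + 1) < s * x} := by
    ext x
    simp only [mem_iUnion]
    constructor
    · exact fun hx => exists_nat_one_div_lt (show 0 < s * x from hx)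
    · rintro ⟨n, hn⟩
      exact lt_trans (by positivity : (0 : ℝ) < 1 / ((n : ℝ) + 1)) hn
  refine absolutelyContinuous_tilt (P := P) hm 0 ?_
  rw [hun]
  exact measure_iUnion_null fun n => hzero _ (by positivity)

lemma MedianBalanced.eq_dirac [IsProbabilityMeasure P] (hm : Measurable ψ)
    (hpos : Dense {y : ℝ | 0 < h y})
    (hψ : BddAbove (range fun x : ℝ => x ^ 2 / 2 - ψ x))
    (H : MedianBalanced h ψ P 0) : P = Measure.dirac 0 := by
  simp only [MedianBalanced, zero_mul] at H
  have h1 : P (Ioi 0) = 0 := by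
    have := measure_halfLine_eq_zero (P := P) hm hψ (s := 1) (by norm_num) fun N => by
      obtain ⟨y, hy, hN⟩ := hpos.exists_gt N
      refine ⟨y, by linarith, ?_⟩
      simpa [Ioi, Iic] using (H y hy).1
    simpa [Ioi] using this
  have h2 : P (Iio 0) = 0 := by
    have := measure_halfLine_eq_zero (P := P) hm hψ (s := -1) (by norm_num) fun N => by
      obtain ⟨y, hy, hN⟩ := hpos.exists_lt (-N)
      refine ⟨y, by linarith, ?_⟩
      simpa [Iio, Ici] using (H y hy).2
    simpa [Iio] using this
  have h3 : P {0}ᶜ = 0 := by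
    rw [← Iio_union_Ioi]
    exact measure_union_null h2 h1
  ext S hS
  by_cases h0 : (0 : ℝ) ∈ S
  · rw [Measure.dirac_apply_of_mem h0, ← prob_compl_eq_zero_iff hS]
    exact measure_mono_null (compl_subset_compl.2 (by simpa using h0)) h3
  · rw [Measure.dirac_apply' _ hS, indicator_of_notMem h0]
    exact measure_mono_null (fun x hx (hx0 : x = 0) => h0 (hx0 ▸ hx)) h3

lemma tilt_dirac_null {y : ℝ} {S : Set ℝ} (hS : MeasurableSet S) (h0 : (0 : ℝ) ∉ S) :
    tilt ψ (Measure.dirac 0) y S = 0 :=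
  withDensity_absolutelyContinuous _ _ (by rw [Measure.dirac_apply' _ hS, indicator_of_notMem h0])

lemma hasLinearMedian_dirac (hfam : IsNaturalExponentialFamily h ψ)
    (hψ : BddAbove (range fun x : ℝ => x ^ 2 / 2 - ψ x)) :
    HasLinearMedian h ψ (Measure.dirac 0) 0 := by
  refine (hasLinearMedian_iff hfam 0).2 fun y _ => ?_
  have := isFiniteMeasure_tilt (P := Measure.dirac 0) hψ y
  have := neZero_tilt (P := Measure.dirac 0) hfam.measurable_logPartition y
  rw [zero_mul]
  refine quantile_normalized_eq ?_ fun x hx => ?_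
  · rw [tilt_dirac_null measurableSet_Ioi (by simp)]
    exact zero_le
  · have h1 : tilt ψ (Measure.dirac 0) y (Iic x) = 0 :=
      tilt_dirac_null measurableSet_Iic (by simpa using hx)
    rw [h1]
    refine pos_iff_ne_zero.2 fun h2 => NeZero.ne (tilt ψ (Measure.dirac 0) y) ?_
    rw [← Measure.measure_univ_eq_zero, ← Iic_union_Ioi (a := x)]
    exact measure_union_null h1 h2

end ZeroSlope

end NatExpFamily

theorem mainTheorem6 (h ψ : ℝ → ℝ)
    (hfam : NatExpFamily.IsNaturalExponentialFamily h ψ)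
    (hpos : Dense {y : ℝ | 0 < h y})
    (hψ : BddAbove (Set.range fun x : ℝ => x ^ 2 / 2 - ψ x))
    (a : ℝ) (ha0 : 0 ≤ a) (ha1 : a < 1) :
    (0 < a →
      (Integrable (NatExpFamily.priorWeight ψ a) →
        IsProbabilityMeasure (NatExpFamily.matchingPrior ψ a)) ∧
      ∀ P : Measure ℝ, IsProbabilityMeasure P →
        (NatExpFamily.SignCondition h ψ P a ↔
          Integrable (NatExpFamily.priorWeight ψ a) ∧ P = NatExpFamily.matchingPrior ψ a) ∧
        (NatExpFamily.HasLinearMedian h ψ P a ↔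
          Integrable (NatExpFamily.priorWeight ψ a) ∧ P = NatExpFamily.matchingPrior ψ a)) ∧
    (a = 0 →
      ∀ P : Measure ℝ, IsProbabilityMeasure P →
        (NatExpFamily.SignCondition h ψ P a ↔ P = Measure.dirac 0) ∧
        (NatExpFamily.HasLinearMedian h ψ P a ↔ P = Measure.dirac 0)) := by
  have hm := hfam.measurable_logPartition
  refine ⟨fun ha => ⟨fun hint => NatExpFamily.isProbabilityMeasure_matchingPrior hm hint,
    fun P hP => ⟨⟨fun H => (H.medianBalanced hfam hψ).eq_matchingPrior hm hpos hψ ha, ?_⟩,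
      ⟨fun H => (H.medianBalanced hfam hψ).eq_matchingPrior hm hpos hψ ha, ?_⟩⟩⟩, ?_⟩
  · rintro ⟨hint, rfl⟩
    exact (NatExpFamily.signCondition_iff hfam hψ a).2 fun y _ =>
      NatExpFamily.tilt_matchingPrior_symm hm ha hint y
  · rintro ⟨hint, rfl⟩
    exact NatExpFamily.hasLinearMedian_matchingPrior hfam hψ ha hint
  · rintro rfl P hP
    refine ⟨⟨fun H => (H.medianBalanced hfam hψ).eq_dirac hm hpos hψ, ?_⟩,
      ⟨fun H => (H.medianBalanced hfam hψ).eq_dirac hm hpos hψ, ?_⟩⟩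
    · rintro rfl
      refine (NatExpFamily.signCondition_iff hfam hψ 0).2 fun y _ => ?_
      rw [NatExpFamily.tilt_dirac_null measurableSet_Ioi (by simp),
        NatExpFamily.tilt_dirac_null measurableSet_Iio (by simp)]
    · rintro rfl
      exact NatExpFamily.hasLinearMedian_dirac hfam hψ
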